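/- Let $n\ge 2$ and let $\Omega_n=\{1<2<\cdots<n\}$ be a chain with $n$ elements. Maps are written on the right, and the partial transformations of $\Omega_n$ form a monoid under composition of partial maps. A partial transformation $s$ of $\Omega_n$ is monotone if it is order-preserving ($x\le y$ implies $xs\le ys$ for all $x,y\in\mathrm{Dom}(s)$) or order-reversing ($x\le y$ implies $xs\ge ys$ for all $x,y\in\mathrm{Dom}(s)$). Let $\mathcal{POD}_n$ be the monoid of all monotone partial transformations of $\Omega_n$, $\mathcal{OD}_n$ its submonoid of all monotone full transformations, and $\mathcal{PODI}_n$ its submonoid of all monotone partial permutations (partial injective transformations). Let $\tau$ be the permutation $i\mapsto n+1-i$ of $\Omega_n$. For each $M\in\{\mathcal{OD}_n,\mathcal{PODI}_n,\mathcal{POD}_n\}$, the map $\phi^\tau\colon M\to M$, $s\mapsto \tau^{-1}s\tau$, is a non-trivial automorphism of $M$, and $$\mathrm{Aut}(M)=\{\mathrm{id},\phi^\tau\}.$$ -/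

import Mathlib

namespace PTrans

/-- The partial transformations of the chain `Fin n`, i.e. of `0 < 1 < ⋯ < n - 1`. -/
def PT (n : ℕ) : Type := Fin n →. Fin n

/-- Composition of partial transformations, maps being written on the right:
`s * t` is "first `s`, then `t`". -/
instance instMonoidPT (n : ℕ) : Monoid (PT n) where
  mul s t := PFun.comp t s
  one := PFun.id (Fin n)
  mul_assoc s t u := (PFun.comp_assoc u t s).symm
  one_mul s := PFun.comp_id s
  mul_one s := PFun.id_comp s

variable {n : ℕ}

/-- `s.Maps x a` says that `x` lies in the domain of `s` and that its image is `a`. -/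
def PT.Maps (s : PT n) (x a : Fin n) : Prop := a ∈ (s : Fin n →. Fin n) x

theorem PT.ext_maps {s t : PT n} (h : ∀ x a, s.Maps x a ↔ t.Maps x a) : s = t :=
  PFun.ext h

theorem PT.maps_unique {s : PT n} {x a b : Fin n} (ha : s.Maps x a) (hb : s.Maps x b) : a = b :=
  Part.mem_unique ha hb

theorem PT.maps_mul {s t : PT n} {x b : Fin n} :
    (s * t).Maps x b ↔ ∃ a, s.Maps x a ∧ t.Maps a b :=
  Part.mem_bind_iff

theorem PT.maps_one {x a : Fin n} : (1 : PT n).Maps x a ↔ a = x :=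
  Part.mem_some_iff

/-- `x ≤ y` implies `xs ≤ ys`, for all `x, y` in the domain of `s`. -/
def OrderPreserving (s : PT n) : Prop :=
  ∀ x y a b, s.Maps x a → s.Maps y b → x ≤ y → a ≤ b

/-- `x ≤ y` implies `xs ≥ ys`, for all `x, y` in the domain of `s`. -/
def OrderReversing (s : PT n) : Prop :=
  ∀ x y a b, s.Maps x a → s.Maps y b → x ≤ y → b ≤ a

/-- A partial transformation that is order-preserving or order-reversing. -/
def IsMonotone (s : PT n) : Prop := OrderPreserving s ∨ OrderReversing s

theorem isMonotone_one : IsMonotone (1 : PT n) := by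
  left
  intro x y a b ha hb h
  rw [PT.maps_one] at ha hb
  subst ha hb
  exact h

theorem IsMonotone.mul {s t : PT n} (hs : IsMonotone s) (ht : IsMonotone t) :
    IsMonotone (s * t) := by
  rcases hs with hs | hs <;> rcases ht with ht | ht
  · left
    intro x y a b ha hb h
    obtain ⟨c, hc, hca⟩ := PT.maps_mul.1 ha
    obtain ⟨d, hd, hdb⟩ := PT.maps_mul.1 hb
    exact ht _ _ _ _ hca hdb (hs _ _ _ _ hc hd h)
  · right
    intro x y a b ha hb h
    obtain ⟨c, hc, hca⟩ := PT.maps_mul.1 ha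
    obtain ⟨d, hd, hdb⟩ := PT.maps_mul.1 hb
    exact ht _ _ _ _ hca hdb (hs _ _ _ _ hc hd h)
  · right
    intro x y a b ha hb h
    obtain ⟨c, hc, hca⟩ := PT.maps_mul.1 ha
    obtain ⟨d, hd, hdb⟩ := PT.maps_mul.1 hb
    exact ht _ _ _ _ hdb hca (hs _ _ _ _ hc hd h)
  · left
    intro x y a b ha hb h
    obtain ⟨c, hc, hca⟩ := PT.maps_mul.1 ha
    obtain ⟨d, hd, hdb⟩ := PT.maps_mul.1 hb
    exact ht _ _ _ _ hdb hca (hs _ _ _ _ hc hd h)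

/-- The monoid of all full transformations of the chain, inside the partial ones. -/
def FullT (n : ℕ) : Submonoid (PT n) where
  carrier := {s | ∀ x, ∃ a, s.Maps x a}
  one_mem' x := ⟨x, PT.maps_one.2 rfl⟩
  mul_mem' {s t} hs ht x := by
    obtain ⟨a, ha⟩ := hs x
    obtain ⟨b, hb⟩ := ht a
    exact ⟨b, PT.maps_mul.2 ⟨a, ha, hb⟩⟩

/-- The monoid of all partial permutations (partial injective transformations) of the chain. -/
def PartialPerm (n : ℕ) : Submonoid (PT n) where
  carrier := {s | ∀ x y a, s.Maps x a → s.Maps y a → x = y}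
  one_mem' x y a hx hy := by
    rw [PT.maps_one] at hx hy
    exact hx.symm.trans hy
  mul_mem' {s t} hs ht x y a hx hy := by
    obtain ⟨c, hc, hca⟩ := PT.maps_mul.1 hx
    obtain ⟨d, hd, hda⟩ := PT.maps_mul.1 hy
    obtain rfl := ht _ _ _ hca hda
    exact hs _ _ _ hc hd

/-- The monoid of all monotone partial transformations of the chain. -/
def POD (n : ℕ) : Submonoid (PT n) where
  carrier := {s | IsMonotone s}
  one_mem' := isMonotone_one
  mul_mem' := IsMonotone.mul

/-- The monoid of all monotone full transformations of the chain. -/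
def OD (n : ℕ) : Submonoid (PT n) := POD n ⊓ FullT n

/-- The monoid of all monotone partial permutations of the chain. -/
def PODI (n : ℕ) : Submonoid (PT n) := POD n ⊓ PartialPerm n

/-- The order-reversing permutation of the chain, as a full transformation. -/
def tauPT (n : ℕ) : PT n := ((Fin.rev : Fin n → Fin n) : Fin n →. Fin n)

theorem maps_tauPT {x a : Fin n} : (tauPT n).Maps x a ↔ a = x.rev :=
  Part.mem_some_iff

theorem tauPT_mul_self : tauPT n * tauPT n = 1 := by
  apply PT.ext_maps
  intro x a
  simp [PT.maps_mul, maps_tauPT, PT.maps_one]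

/-- The order-reversing permutation of the chain, as a unit of the monoid of partial
transformations. -/
def tau (n : ℕ) : (PT n)ˣ := ⟨tauPT n, tauPT n, tauPT_mul_self, tauPT_mul_self⟩

theorem tau_mem_POD : (tau n : PT n) ∈ POD n := by
  right
  intro x y a b ha hb h
  have ha' := maps_tauPT.1 ha
  have hb' := maps_tauPT.1 hb
  subst ha' hb'
  exact Fin.rev_le_rev.2 h

theorem tau_mem_OD : (tau n : PT n) ∈ OD n :=
  ⟨tau_mem_POD, fun x => ⟨x.rev, maps_tauPT.2 rfl⟩⟩

theorem tau_mem_PODI : (tau n : PT n) ∈ PODI n :=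
  ⟨tau_mem_POD, fun _ _ _ hx hy =>
    Fin.rev_injective ((maps_tauPT.1 hx).symm.trans (maps_tauPT.1 hy))⟩

/-- The inner automorphism `s ↦ u⁻¹ s u` of a submonoid `M` of a monoid `P`, for a unit `u`
of `P` with `u⁻¹ M u = M`. -/
def innerAut {P : Type*} [Monoid P] (M : Submonoid P) (u : Pˣ)
    (h : ∀ s : P, (↑u⁻¹ * s * ↑u : P) ∈ M ↔ s ∈ M) : MulAut M where
  toFun s := ⟨↑u⁻¹ * s * ↑u, (h s).2 s.2⟩
  invFun s := ⟨↑u * s * ↑u⁻¹, (h _).1 (by simp [mul_assoc])⟩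
  left_inv s := Subtype.ext (by simp [mul_assoc])
  right_inv s := Subtype.ext (by simp [mul_assoc])
  map_mul' s t := Subtype.ext (by simp [mul_assoc])

theorem tau_conj_mem_iff {M : Submonoid (PT n)} (hM : M = OD n ∨ M = PODI n ∨ M = POD n)
    (s : PT n) : (↑(tau n)⁻¹ * s * ↑(tau n) : PT n) ∈ M ↔ s ∈ M := by
  have ht : (tau n : PT n) ∈ M := by
    rcases hM with rfl | rfl | rfl
    · exact tau_mem_OD
    · exact tau_mem_PODI
    · exact tau_mem_POD
  have hi : (↑(tau n)⁻¹ : PT n) ∈ M := ht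
  refine ⟨fun h => ?_, fun h => M.mul_mem (M.mul_mem hi h) ht⟩
  have := M.mul_mem (M.mul_mem ht h) hi
  simpa [mul_assoc] using this

/-- The automorphism `φ^τ : s ↦ τ⁻¹ s τ` of each of the three monoids of monotone
transformations. -/
def phiTau {M : Submonoid (PT n)} (hM : M = OD n ∨ M = PODI n ∨ M = POD n) : MulAut M :=
  innerAut M (tau n) (tau_conj_mem_iff hM)

end PTrans

/-!
Why the automorphism group is `{id, φ^τ}`.

Each of the three monoids `M` contains, for every antitone map `g` of the chain and every set `S`
on which `g` is injective, a restriction of `g` that is defined on all of `S`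
(`exists_mem_of_antitone`). Only two instances of this are used.

Constant maps `g`, with `S` a single point, show that the elements of rank one can be recognised
inside `M` by multiplication alone (`exists_isPoint_iff`), and that two of them have the same image
point exactly when each is a left multiple of the other. So an automorphism `f` permutes the
image points of the elements of rank one. If `σ` is this permutation, then `f s` maps `σ a` to
`σ b` exactly when `s` maps `a` to `b` (`exists_perm_of_mulAut`): `f` is conjugation by `σ`.

For `a < b < c`, an antitone `g` with `a ↦ c`, `b ↦ b`, `c ↦ a` gives an element of `M`
whose conjugate by `σ` fixes `σ b` and swaps `σ a` with `σ c`. As the conjugate is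
monotone, `σ b` lies between `σ a` and `σ c` (`between_of_swap`). A map of a chain that preserves
betweenness is monotone or antitone, and a permutation of a finite chain with this property is the
identity or the reversal.
-/

namespace PTrans

variable {n : ℕ} {M : Submonoid (PT n)}

/-! ### Supply of elements in the three monoids -/

/-- The restriction of the map `g` to the set `S`, as a partial transformation. -/
def restrict (S : Set (Fin n)) (g : Fin n → Fin n) : PT n := fun x => ⟨x ∈ S, fun _ => g x⟩

theorem maps_restrict {S : Set (Fin n)} {g : Fin n → Fin n} {x a : Fin n} :
    (restrict S g).Maps x a ↔ x ∈ S ∧ g x = a :=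
  ⟨fun ⟨h, e⟩ => ⟨h, e⟩, fun ⟨h, e⟩ => ⟨h, e⟩⟩

theorem restrict_mem_POD (S : Set (Fin n)) {g : Fin n → Fin n} (hg : Antitone g) :
    restrict S g ∈ POD n := by
  right
  intro x y a b ha hb h
  rw [← (maps_restrict.1 ha).2, ← (maps_restrict.1 hb).2]
  exact hg h

/-- The set `S` has to lie in the domain, but need not be all of it: the witness is `g` itself in
`OD n` and `POD n`, and the restriction of `g` to `S` in `PODI n`. -/
theorem exists_mem_of_antitone (hM : M = OD n ∨ M = PODI n ∨ M = POD n) {g : Fin n → Fin n}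
    (hg : Antitone g) {S : Set (Fin n)} (hS : Set.InjOn g S) :
    ∃ s ∈ M, (∀ x ∈ S, s.Maps x (g x)) ∧ ∀ x a, s.Maps x a → a = g x := by
  rcases hM with rfl | rfl | rfl
  · exact ⟨restrict Set.univ g,
      ⟨restrict_mem_POD _ hg, fun x => ⟨g x, maps_restrict.2 ⟨trivial, rfl⟩⟩⟩,
      fun x _ => maps_restrict.2 ⟨trivial, rfl⟩, fun x a h => (maps_restrict.1 h).2.symm⟩
  · refine ⟨restrict S g, ⟨restrict_mem_POD _ hg, fun x y a hx hy => ?_⟩,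
      fun x hx => maps_restrict.2 ⟨hx, rfl⟩, fun x a h => (maps_restrict.1 h).2.symm⟩
    obtain ⟨hx, ex⟩ := maps_restrict.1 hx
    obtain ⟨hy, ey⟩ := maps_restrict.1 hy
    exact hS hx hy (ex.trans ey.symm)
  · exact ⟨restrict Set.univ g, restrict_mem_POD _ hg,
      fun x _ => maps_restrict.2 ⟨trivial, rfl⟩, fun x a h => (maps_restrict.1 h).2.symm⟩

/-- The submonoid `M` has, for all points `x` and `a`, an element that maps `x` to `a` and has no
other image point. -/
def HasPoints (M : Submonoid (PT n)) : Prop :=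
  ∀ x a, ∃ r : M, r.1.Maps x a ∧ ∀ y b, r.1.Maps y b → b = a

theorem hasPoints (hM : M = OD n ∨ M = PODI n ∨ M = POD n) : HasPoints M := by
  intro x a
  obtain ⟨s, hs, h1, h2⟩ := exists_mem_of_antitone hM (g := fun _ => a) antitone_const
    (Set.injOn_singleton _ x)
  exact ⟨⟨s, hs⟩, h1 x rfl, h2⟩

theorem exists_swap (hM : M = OD n ∨ M = PODI n ∨ M = POD n) {a b c : Fin n} (hab : a < b)
    (hbc : b < c) : ∃ s : M, s.1.Maps a c ∧ s.1.Maps b b ∧ s.1.Maps c a := by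
  let g : Fin n → Fin n := fun x => if x < b then c else if x = b then b else a
  have ga : g a = c := by simp [g, hab]
  have gb : g b = b := by simp [g]
  have gc : g c = a := by simp [g, hbc.not_gt, hbc.ne']
  have hg : Antitone g := by
    intro x y h
    simp only [g]
    split_ifs <;> order
  have hS : Set.InjOn g {a, b, c} := by
    rintro x (rfl | rfl | rfl) y (rfl | rfl | rfl) h <;>
      first | rfl | (simp only [ga, gb, gc] at h; order)
  obtain ⟨s, hs, h1, -⟩ := exists_mem_of_antitone hM hg hS
  exact ⟨⟨s, hs⟩, ga ▸ h1 a (by simp), by simpa only [gb] using h1 b (by simp),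
    gc ▸ h1 c (by simp)⟩

/-! ### Recognising the elements of rank one -/

/-- The partial transformation `r` has rank one, and `a` is its only image point. -/
def IsPoint (r : PT n) (a : Fin n) : Prop :=
  (∃ x, r.Maps x a) ∧ ∀ y b, r.Maps y b → b = a

theorem IsPoint.unique {r : PT n} {a b : Fin n} (ha : IsPoint r a) (hb : IsPoint r b) : a = b := by
  obtain ⟨x, hx⟩ := ha.1
  exact hb.2 x a hx

theorem IsPoint.mul {r s : PT n} {a b : Fin n} (hr : IsPoint r a) (hs : s.Maps a b) :
    IsPoint (r * s) b := by
  obtain ⟨⟨x, hx⟩, h⟩ := hr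
  refine ⟨⟨x, PT.maps_mul.2 ⟨a, hx, hs⟩⟩, fun y c hc => ?_⟩
  obtain ⟨d, hd, hdc⟩ := PT.maps_mul.1 hc
  obtain rfl := h y d hd
  exact PT.maps_unique hdc hs

/-- The elements that absorb every right factor are the empty ones; in `OD n` there are none. -/
theorem forall_mul_eq_self_iff (hn : 2 ≤ n) (hM : HasPoints M) (z : M) :
    (∀ t : M, z * t = z) ↔ ∀ x a, ¬ z.1.Maps x a := by
  constructor
  · intro h x a hx
    have : Nontrivial (Fin n) := Fin.nontrivial_iff_two_le.2 hn
    obtain ⟨b, hb⟩ := exists_ne a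
    obtain ⟨r, hr, -⟩ := hM a b
    have hzb : (z * r).1.Maps x b := PT.maps_mul.2 ⟨a, hx, hr⟩
    rw [h r] at hzb
    exact hb (PT.maps_unique hzb hx)
  · intro h t
    refine Subtype.ext (PT.ext_maps fun x a => ⟨fun hx => ?_, fun hx => (h x a hx).elim⟩)
    obtain ⟨b, hb, -⟩ := PT.maps_mul.1 hx
    exact (h x b hb).elim

/-- An element of rank one is a left multiple of every element with the same image point. -/
theorem IsPoint.exists_mul_eq (hM : HasPoints M) {r s : M} {a : Fin n} (hr : IsPoint r.1 a)
    (hs : ∃ x, s.1.Maps x a) : ∃ u : M, u * s = r := by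
  obtain ⟨x, hx⟩ := hs
  obtain ⟨q, hq, hq'⟩ := hM a x
  -- The left factor has to have the domain of `r`, which `r * q` has.
  refine ⟨r * q, Subtype.ext (PT.ext_maps fun y b => ⟨fun h => ?_, fun h => ?_⟩)⟩
  · obtain ⟨d, hd, hdb⟩ := PT.maps_mul.1 h
    obtain ⟨c, hc, hcd⟩ := PT.maps_mul.1 hd
    obtain rfl := hr.2 y c hc
    obtain rfl := hq' _ d hcd
    rwa [PT.maps_unique hdb hx]
  · obtain rfl := hr.2 y b h
    exact PT.maps_mul.2 ⟨x, PT.maps_mul.2 ⟨b, h, hq⟩, hx⟩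

/-- The elements of rank one are the nonempty `r` that are left multiples of all their nonempty
left multiples, "nonempty" being expressed by multiplication as in `forall_mul_eq_self_iff`. -/
theorem exists_isPoint_iff (hn : 2 ≤ n) (hM : HasPoints M) (r : M) :
    (∃ a, IsPoint r.1 a) ↔ (¬ ∀ v, r * v = r) ∧
      ∀ t : M, (¬ ∀ v, t * r * v = t * r) → ∃ u, u * (t * r) = r := by
  simp only [forall_mul_eq_self_iff hn hM, not_forall, not_not]
  constructor
  · rintro ⟨a, ha⟩
    refine ⟨ha.1.imp fun x hx => ⟨a, hx⟩, fun t ⟨y, b, hy⟩ => ha.exists_mul_eq hM ⟨y, ?_⟩⟩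
    obtain ⟨c, -, hcb⟩ := PT.maps_mul.1 hy
    rwa [← ha.2 c b hcb]
  · rintro ⟨⟨x, a, hx⟩, h⟩
    obtain ⟨t, ht, ht'⟩ := hM x x
    have htr : IsPoint (t * r).1 a := IsPoint.mul ⟨⟨x, ht⟩, ht'⟩ hx
    obtain ⟨u, hu⟩ := h t ⟨x, a, PT.maps_mul.2 ⟨x, ht, hx⟩⟩
    refine ⟨a, ⟨x, hx⟩, fun y b hy => ?_⟩
    rw [← hu] at hy
    obtain ⟨c, -, hcb⟩ := PT.maps_mul.1 hy
    exact htr.2 c b hcb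

/-- The criterion `exists_isPoint_iff` is multiplicative, hence invariant under automorphisms. -/
theorem exists_isPoint_map (hn : 2 ≤ n) (hM : HasPoints M) (f : MulAut M) {r : M} {a : Fin n}
    (hr : IsPoint r.1 a) : ∃ b, IsPoint (f r).1 b := by
  obtain ⟨h1, h2⟩ := (exists_isPoint_iff hn hM r).1 ⟨a, hr⟩
  refine (exists_isPoint_iff hn hM _).2 ⟨?_, fun t ht => ?_⟩
  · exact fun h => h1 fun v => f.injective (by rw [map_mul, h])
  · obtain ⟨t, rfl⟩ := f.surjective t
    obtain ⟨u, hu⟩ := h2 t fun h => ht fun v => by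
      obtain ⟨v, rfl⟩ := f.surjective v
      rw [← map_mul, ← map_mul, h]
    exact ⟨f u, by rw [← map_mul, ← map_mul, hu]⟩

/-! ### Automorphisms are conjugations by permutations -/

/-- An automorphism acts on image points: the image point of `f r` depends only on that of `r`,
since `r` is a left multiple of each element with the same image point. -/
theorem exists_pointMap (hn : 2 ≤ n) (hM : HasPoints M) (f : MulAut M) :
    ∃ σ : Fin n → Fin n, ∀ (r : M) (a : Fin n), IsPoint r.1 a → IsPoint (f r).1 (σ a) := by
  choose e he he' using fun a => hM a a
  choose σ hσ using fun a => exists_isPoint_map hn hM f (r := e a) ⟨⟨a, he a⟩, he' a⟩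
  refine ⟨σ, fun r a hr => ?_⟩
  obtain ⟨b, hb⟩ := exists_isPoint_map hn hM f hr
  obtain ⟨u, hu⟩ := hr.exists_mul_eq hM ⟨a, he a⟩
  obtain ⟨x, hx⟩ := hb.1
  have hx' := hx
  rw [← hu, map_mul] at hx'
  obtain ⟨c, -, hcb⟩ := PT.maps_mul.1 hx'
  rwa [← (hσ a).2 c b hcb]

/-- If `r` has rank one and image point `a`, then `s` maps `a` to `b` exactly when `r * s` has rank
one and image point `b`; so the action on image points determines `f s`. -/
theorem exists_perm_of_mulAut (hn : 2 ≤ n) (hM : HasPoints M) (f : MulAut M) :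
    ∃ σ : Equiv.Perm (Fin n), ∀ (s : M) (a b : Fin n),
      (f s).1.Maps (σ a) (σ b) ↔ s.1.Maps a b := by
  obtain ⟨σ, hσ⟩ := exists_pointMap hn hM f
  obtain ⟨ρ, hρ⟩ := exists_pointMap hn hM f.symm
  have hρσ : ∀ a, ρ (σ a) = a := fun a => by
    obtain ⟨r, hr, hr'⟩ := hM a a
    have h := hρ _ _ (hσ r a ⟨⟨a, hr⟩, hr'⟩)
    rw [MulEquiv.symm_apply_apply] at h
    exact h.unique ⟨⟨a, hr⟩, hr'⟩
  have hσρ : ∀ a, σ (ρ a) = a := fun a => by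
    obtain ⟨r, hr, hr'⟩ := hM a a
    have h := hσ _ _ (hρ r a ⟨⟨a, hr⟩, hr'⟩)
    rw [MulEquiv.apply_symm_apply] at h
    exact h.unique ⟨⟨a, hr⟩, hr'⟩
  have key : ∀ (g : MulAut M) (π : Fin n → Fin n),
      (∀ (r : M) (a : Fin n), IsPoint r.1 a → IsPoint (g r).1 (π a)) →
      ∀ (s : M) (a b : Fin n), s.1.Maps a b → (g s).1.Maps (π a) (π b) := by
    intro g π hπ s a b hs
    obtain ⟨r, hr, hr'⟩ := hM a a
    have hra : IsPoint r.1 a := ⟨⟨a, hr⟩, hr'⟩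
    obtain ⟨x, hx⟩ := (hπ (r * s) b (hra.mul hs)).1
    rw [map_mul] at hx
    obtain ⟨c, hc, hcb⟩ := PT.maps_mul.1 hx
    rwa [(hπ r a hra).2 x c hc] at hcb
  refine ⟨⟨σ, ρ, hρσ, hσρ⟩, fun s a b => ⟨fun h => ?_, key f σ hσ s a b⟩⟩
  have h' := key f.symm ρ hρ _ _ _ h
  rwa [MulEquiv.symm_apply_apply, Equiv.coe_fn_mk, hρσ, hρσ] at h'

/-! ### The permutation is the identity or the reversal -/

theorem between_of_swap {s : PT n} (hs : IsMonotone s) {a b c : Fin n} (hne : a ≠ c)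
    (hac : s.Maps a c) (hb : s.Maps b b) (hca : s.Maps c a) :
    ¬ (a < b ∧ c < b ∨ b < a ∧ b < c) := by
  rcases hs with hs | hs
  · -- The swapped pair `a`, `c` rules out the order-preserving case.
    have h1 := hs _ _ _ _ hac hca
    have h2 := hs _ _ _ _ hca hac
    rcases le_total a c with h | h
    · exact (hne (h.antisymm (h1 h))).elim
    · exact (hne ((h2 h).antisymm h)).elim
  · rintro (⟨h1, h2⟩ | ⟨h1, h2⟩)
    · exact (hs _ _ _ _ hac hb h1.le).not_gt h2
    · exact (hs _ _ _ _ hb hac h1.le).not_gt h2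

theorem perm_eq_one_or_rev (σ : Equiv.Perm (Fin n))
    (h : ∀ a b c, a < b → b < c → ¬ (σ a < σ b ∧ σ c < σ b ∨ σ b < σ a ∧ σ b < σ c)) :
    (∀ a, σ a = a) ∨ ∀ a, σ a = a.rev := by
  by_cases hm : Monotone σ
  · left
    have h := ((hm.strictMono_of_injective σ.injective).range_inj strictMono_id).1
      (by simp [σ.surjective.range_eq])
    exact congrFun h
  by_cases ha : Antitone σ
  · right
    have h := ((ha.strictAnti_of_injective σ.injective).range_inj Fin.rev_strictAnti).1
      (by simp [σ.surjective.range_eq, Fin.rev_surjective.range_eq])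
    exact congrFun h
  obtain ⟨a, b, c, hab, hbc, hf⟩ := not_monotone_not_antitone_iff_exists_lt_lt.1 ⟨hm, ha⟩
  exact (h a b c hab hbc hf).elim

theorem isMonotone_of_mem (hM : M = OD n ∨ M = PODI n ∨ M = POD n) (s : M) : IsMonotone s.1 := by
  rcases hM with rfl | rfl | rfl
  exacts [s.2.1, s.2.1, s.2]

theorem maps_phiTau (hM : M = OD n ∨ M = PODI n ∨ M = POD n) (s : M) (a b : Fin n) :
    (phiTau hM s).1.Maps a.rev b.rev ↔ s.1.Maps a b := by
  change (tauPT n * s.1 * tauPT n).Maps _ _ ↔ _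
  simp only [PT.maps_mul, maps_tauPT]
  simp [Fin.rev_inj]

end PTrans

theorem mainTheorem2 (n : ℕ) (hn : 2 ≤ n) (M : Submonoid (PTrans.PT n))
    (hM : M = PTrans.OD n ∨ M = PTrans.PODI n ∨ M = PTrans.POD n) :
    (Set.univ : Set (MulAut M)) = {MulEquiv.refl M, PTrans.phiTau hM} ∧
      PTrans.phiTau hM ≠ MulEquiv.refl M := by
  have hP := PTrans.hasPoints hM
  refine ⟨(Set.eq_univ_of_forall fun f => ?_).symm, fun h => ?_⟩
  · obtain ⟨σ, hσ⟩ := PTrans.exists_perm_of_mulAut hn hP f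
    have hσ' : (∀ a, σ a = a) ∨ ∀ a, σ a = a.rev := by
      refine PTrans.perm_eq_one_or_rev σ fun a b c hab hbc => ?_
      obtain ⟨s, h1, h2, h3⟩ := PTrans.exists_swap hM hab hbc
      exact PTrans.between_of_swap (PTrans.isMonotone_of_mem hM (f s))
        (σ.injective.ne (hab.trans hbc).ne)
        ((hσ s _ _).2 h1) ((hσ s _ _).2 h2) ((hσ s _ _).2 h3)
    rcases hσ' with h | h
    · left
      refine MulEquiv.ext fun s => Subtype.ext (PTrans.PT.ext_maps fun a b => ?_)
      simpa only [h, MulEquiv.refl_apply] using hσ s a b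
    · right
      refine MulEquiv.ext fun s => Subtype.ext (PTrans.PT.ext_maps fun a b => ?_)
      have h1 := hσ s a.rev b.rev
      have h2 := PTrans.maps_phiTau hM s a.rev b.rev
      simp only [h, Fin.rev_rev] at h1 h2
      exact h1.trans h2.symm
  · let a : Fin n := ⟨0, by omega⟩
    obtain ⟨r, hr, hr'⟩ := hP a a
    have h1 := (PTrans.maps_phiTau hM r a a).2 hr
    rw [h] at h1
    have h2 := congrArg Fin.val (hr' _ _ h1)
    simp only [a, Fin.val_rev] at h2
    omega
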